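/- Fix a topological space $B$. A fibrewise space is a topological space $X$ with a continuous projection $p_X:X\to B$; a fibrewise map is a continuous map commuting with the projections. Write $I=[0,1]$, and give $X\times I$ the projection $(x,t)\mapsto p_X(x)$; a fibrewise homotopy is a fibrewise map $X\times I\to Y$, and $\simeq_B$ is the corresponding relation. A fibrewise map $j:A\to X$ is a closed fibrewise cofibration if it has the homotopy extension property for all fibrewise maps and fibrewise homotopies and $j(A)$ is closed in $X$. Write $X\times_BY$ for the fibre product and $\prod_B^{m}X$ for the fibre product of $m$ copies of $X$. Join. For fibrewise maps $h:Y\to K$, $k:Z\to K$ let $L$ be the space of $(y,(b,\theta),z)$ with $y\in Y$, $z\in Z$, $b\in B$, $\theta$ a path in $p_K^{-1}(b)$ (compact-open topology), $h(y)=\theta(0)$, $k(z)=\theta(1)$. The fibrewise join of $h$ and $k$ is the quotient of $Y\sqcup (L\times I)\sqcup Z$ by the relation generated by $(\ell,0)\sim y$, $(\ell,1)\sim z$ for $\ell=(y,(b,\theta),z)\in L$; the join map to $K$ is $h$ on $Y$, $k$ on $Z$ and $(\ell,t)\mapsto\theta(t)$ on $L\times I$. Let $f:E\to X$ be a fibrewise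 map. An open $U\subseteq X$ is fibrewise sectional if there is a fibrewise map $s:U\to E$ such that $fs$ is fibrewise homotopic to the inclusion $U\hookrightarrow X$; $\mathrm{secat}_B(f)$ is the least $n\ge 0$ such that $X$ is covered by $n+1$ fibrewise sectional open subsets ($\infty$ if there is none). The fibrewise sectional fat wedge $j_n:T^n_B(f)\to\prod_B^{n+1}X$ is defined by $T^0_B(f)=E$, $j_0=f$, and, for $n\ge1$, $j_n$ is the join map of $f\times_B\mathrm{id}:E\times_B\prod_B^nX\to\prod_B^{n+1}X$ and $\mathrm{id}_X\times_Bj_{n-1}:X\times_BT^{n-1}_B(f)\to\prod_B^{n+1}X$. The Ganea map $p_n:G^n_B(f)\to X$ is defined by $G^0_B(f)=E$, $p_0=f$, and, for $n\ge1$, $p_n$ is the join map of $p_{n-1}$ and $f$. **Theorem.** Let $f:E\to X$ be a fibrewise map over $B$ such that either $E$ and $X$ are normal, or $f$ is a closed fibrewise cofibration and $X$ is normal. Then for every integer $n\ge0$ the following are equivalent: (i) $\mathrm{secat}_B(f)\le n$; (ii) there is a fibrewise map $\varphi:X\to T^n_B(f)$ with $\Delta_{n+1}\simeq_B j_n\varphi$,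 where $\Delta_{n+1}:X\to\prod_B^{n+1}X$ is the diagonal; (iii) there is a fibrewise map $\sigma:X\to G^n_B(f)$ with $p_n\sigma\simeq_B\mathrm{id}_X$. -/

import Mathlib

open Set unitInterval

universe u

/-- A fibrewise space over `B`: a topological space with a continuous projection to `B`. -/
structure FibSpace (B : Type u) [TopologicalSpace B] where
  carrier : Type u
  [top : TopologicalSpace carrier]
  proj : C(carrier, B)

namespace FibSpace

instance {B : Type u} [TopologicalSpace B] : CoeSort (FibSpace B) (Type u) := ⟨FibSpace.carrier⟩

instance {B : Type u} [TopologicalSpace B] (X : FibSpace B) : TopologicalSpace X := X.top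

end FibSpace

/-- A fibrewise map over `B`: a continuous map commuting with the projections. -/
structure FibMap {B : Type u} [TopologicalSpace B] (X Y : FibSpace B) where
  toMap : C(X, Y)
  proj_comp : ∀ x, Y.proj (toMap x) = X.proj x

section Basic

variable {B : Type u} [TopologicalSpace B]

instance FibMap.instCoeFun (X Y : FibSpace B) : CoeFun (FibMap X Y) (fun _ => X → Y) :=
  ⟨fun f => f.toMap⟩

theorem FibMap.continuous {X Y : FibSpace B} (f : FibMap X Y) : Continuous f :=
  f.toMap.continuous

def FibMap.id (X : FibSpace B) : FibMap X X := ⟨ContinuousMap.id X, fun _ => rfl⟩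

def FibMap.comp {X Y Z : FibSpace B} (g : FibMap Y Z) (f : FibMap X Y) : FibMap X Z :=
  ⟨g.toMap.comp f.toMap, fun x => (g.proj_comp (f x)).trans (f.proj_comp x)⟩

/-- The fibrewise cylinder `I_B(X)`: the product `X × I`, projected to `B` through `X`. -/
def FibSpace.cyl (X : FibSpace B) : FibSpace B where
  carrier := X × I
  proj := X.proj.comp ContinuousMap.fst

/-- The map `I_B(f) : I_B(X) → I_B(Y)`. -/
def FibMap.cyl {X Y : FibSpace B} (f : FibMap X Y) : FibMap X.cyl Y.cyl where
  toMap := f.toMap.prodMap (ContinuousMap.id I)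
  proj_comp := fun x => f.proj_comp x.1

/-- `H` is a fibrewise homotopy from `f` to `g`. -/
def IsFibHomotopy {X Y : FibSpace B} (H : FibMap X.cyl Y) (f g : FibMap X Y) : Prop :=
  (∀ x : X, H (x, (0 : I)) = f x) ∧ ∀ x : X, H (x, (1 : I)) = g x

/-- The relation `f ≃_B g`. -/
def FibHomotopic {X Y : FibSpace B} (f g : FibMap X Y) : Prop :=
  ∃ H : FibMap X.cyl Y, IsFibHomotopy H f g

/-- Fibrewise cofibrations: the homotopy extension property over `B`. -/
def IsFibCofibration {A X : FibSpace B} (j : FibMap A X) : Prop :=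
  ∀ (Y : FibSpace.{u} B) (f : FibMap X Y) (H : FibMap A.cyl Y),
    (∀ a : A, H (a, (0 : I)) = f (j a)) →
    ∃ K : FibMap X.cyl Y, (∀ x : X, K (x, (0 : I)) = f x) ∧
      ∀ (a : A) (t : I), K (j a, t) = H (a, t)

/-- A closed fibrewise cofibration: a fibrewise cofibration with closed image. -/
def IsClosedFibCofibration {A X : FibSpace B} (j : FibMap A X) : Prop :=
  IsFibCofibration j ∧ IsClosed (range j)

/-- The fibrewise product `X ×_B Y`. -/
def FibSpace.prod (X Y : FibSpace B) : FibSpace B where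
  carrier := {p : X × Y // X.proj p.1 = Y.proj p.2}
  proj := ⟨fun p => X.proj p.1.1, by fun_prop⟩

/-- The product `f ×_B g` of two fibrewise maps. -/
def FibMap.prodMap {X X' Y Y' : FibSpace B} (f : FibMap X X') (g : FibMap Y Y') :
    FibMap (X.prod Y) (X'.prod Y') where
  toMap :=
    ⟨fun p => ⟨(f p.1.1, g p.1.2),
        (f.proj_comp p.1.1).trans (p.2.trans (g.proj_comp p.1.2).symm)⟩,
      Continuous.subtype_mk
        ((f.continuous.comp (continuous_fst.comp continuous_subtype_val)).prodMk
          (g.continuous.comp (continuous_snd.comp continuous_subtype_val))) _⟩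
  proj_comp := fun p => f.proj_comp p.1.1

/-- The map `(f, g) : X → Y ×_B Z`. -/
def FibMap.prodLift {X Y Z : FibSpace B} (f : FibMap X Y) (g : FibMap X Z) :
    FibMap X (Y.prod Z) where
  toMap :=
    ⟨fun x => ⟨(f x, g x), (f.proj_comp x).trans (g.proj_comp x).symm⟩,
      Continuous.subtype_mk (f.continuous.prodMk g.continuous) _⟩
  proj_comp := fun x => f.proj_comp x

/-- `X.power n` is the fibrewise product of `n + 1` copies of `X`, that is
`X ×_B (X ×_B (⋯ ×_B X))`. -/
def FibSpace.power (X : FibSpace B) : ℕ → FibSpace B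
  | 0 => X
  | n + 1 => X.prod (X.power n)

/-- The diagonal map of `X` into the fibrewise product of `n + 1` copies of `X`. -/
def FibSpace.diag (X : FibSpace B) : (n : ℕ) → FibMap X (X.power n)
  | 0 => FibMap.id X
  | n + 1 => FibMap.prodLift (FibMap.id X) (X.diag n)

/-- The fibrewise free path space `P_B(X)`: pairs `(b, α)` with `α` a path in the fibre over `b`
(`C(I, X)` has the compact-open topology). -/
def FibSpace.pathSpace (X : FibSpace B) : FibSpace B where
  carrier := {p : B × C(I, X) // ∀ t, X.proj (p.2 t) = p.1}
  proj := ⟨fun p => p.1.1, by fun_prop⟩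

/-- The path `α` underlying a point `(b, α)` of `P_B(X)`. -/
def FibSpace.path (X : FibSpace B) (w : X.pathSpace) : C(I, X) := (Subtype.val w).2

theorem FibSpace.continuous_path (X : FibSpace B) : Continuous X.path :=
  continuous_snd.comp continuous_subtype_val

theorem FibSpace.proj_path (X : FibSpace B) (w : X.pathSpace) (t : I) :
    X.proj (X.path w t) = X.pathSpace.proj w := w.2 t

section Join

variable {Y Z K : FibSpace B}

/-- The standard fibrewise homotopy pullback of `h : Y → K` and `k : Z → K`: triples
`(y, (b, θ), z)` with `h y = θ 0` and `k z = θ 1`, projected to `b`. -/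
def hPullback (h : FibMap Y K) (k : FibMap Z K) : FibSpace B where
  carrier := {q : Y × K.pathSpace × Z //
    h q.1 = K.path q.2.1 0 ∧ k q.2.2 = K.path q.2.1 1}
  proj := K.pathSpace.proj.comp
    ⟨fun q => q.1.2.1, continuous_fst.comp (continuous_snd.comp continuous_subtype_val)⟩

def hPullbackFst (h : FibMap Y K) (k : FibMap Z K) : FibMap (hPullback h k) Y where
  toMap := ⟨fun q => q.1.1, continuous_fst.comp continuous_subtype_val⟩
  proj_comp := fun q => by
    rw [← h.proj_comp]
    exact (congrArg K.proj q.2.1).trans (K.proj_path q.1.2.1 0)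

def hPullbackSnd (h : FibMap Y K) (k : FibMap Z K) : FibMap (hPullback h k) Z where
  toMap := ⟨fun q => q.1.2.2,
    continuous_snd.comp (continuous_snd.comp continuous_subtype_val)⟩
  proj_comp := fun q => by
    rw [← k.proj_comp]
    exact (congrArg K.proj q.2.2).trans (K.proj_path q.1.2.1 1)

/-- The canonical fibrewise homotopy `G (y, (b, θ), z, t) = θ t`. -/
def hPullbackHomotopy (h : FibMap Y K) (k : FibMap Z K) :
    FibMap (hPullback h k).cyl K where
  toMap := ⟨fun w => K.path w.1.1.2.1 w.2, by
    have h1 : Continuous fun w : (hPullback h k) × I => K.path w.1.1.2.1 :=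
      K.continuous_path.comp (continuous_fst.comp
        (continuous_snd.comp (continuous_subtype_val.comp continuous_fst)))
    exact ContinuousEval.continuous_eval.comp (h1.prodMk continuous_snd)⟩
  proj_comp := fun w => K.proj_path w.1.1.2.1 w.2

theorem hPullbackHomotopy_isFibHomotopy (h : FibMap Y K) (k : FibMap Z K) :
    IsFibHomotopy (hPullbackHomotopy h k) (h.comp (hPullbackFst h k))
      (k.comp (hPullbackSnd h k)) :=
  ⟨fun q => q.2.1.symm, fun q => q.2.2.symm⟩

variable {X : FibSpace B}

/-- The elementary relations `(x, 0) ∼ f x` and `(x, 1) ∼ g x` on `Y ⊔ I_B(X) ⊔ Z`. -/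
inductive HPushoutRel (f : FibMap X Y) (g : FibMap X Z) :
    Y ⊕ (X.cyl ⊕ Z) → Y ⊕ (X.cyl ⊕ Z) → Prop
  | zero (x : X) : HPushoutRel f g (Sum.inr (Sum.inl (x, (0 : I)))) (Sum.inl (f x))
  | one (x : X) : HPushoutRel f g (Sum.inr (Sum.inl (x, (1 : I)))) (Sum.inr (Sum.inr (g x)))

/-- The map induced on the quotient of `Y ⊔ I_B(X) ⊔ Z` by three compatible maps. -/
def hPushoutDesc {T : Type u} [TopologicalSpace T] (f : FibMap X Y) (g : FibMap X Z)
    (a : C(Y, T)) (c : C(X.cyl, T)) (b : C(Z, T))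
    (h0 : ∀ x : X, c (x, (0 : I)) = a (f x)) (h1 : ∀ x : X, c (x, (1 : I)) = b (g x)) :
    C(Quot (HPushoutRel f g), T) where
  toFun := Quot.lift (Sum.elim a (Sum.elim c b)) (by
    rintro _ _ (x | x)
    · exact h0 x
    · exact h1 x)
  continuous_toFun := continuous_quot_lift _
    (a.continuous.sumElim (c.continuous.sumElim b.continuous))

/-- The (standard) fibrewise homotopy pushout `C_{f,g}` of `f : X → Y` and `g : X → Z`,
the quotient of `Y ⊔ I_B(X) ⊔ Z` by the equivalence relation generated by `(x, 0) ∼ f x` and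
`(x, 1) ∼ g x`, with the quotient topology. -/
def hPushout (f : FibMap X Y) (g : FibMap X Z) : FibSpace B where
  carrier := Quot (HPushoutRel f g)
  proj := hPushoutDesc f g Y.proj X.cyl.proj Z.proj
    (fun x => (f.proj_comp x).symm) (fun x => (g.proj_comp x).symm)

/-- The fibrewise co-whisker map `C_{f,g} → K` given by a homotopy `H` from `h f` to `k g`. -/
def coWhisker (f : FibMap X Y) (g : FibMap X Z) (h : FibMap Y K) (k : FibMap Z K)
    (H : FibMap X.cyl K) (hH : IsFibHomotopy H (h.comp f) (k.comp g)) :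
    FibMap (hPushout f g) K where
  toMap := hPushoutDesc f g h.toMap H.toMap k.toMap hH.1 hH.2
  proj_comp := by
    rintro ⟨y | w | z⟩
    · exact h.proj_comp y
    · exact H.proj_comp w
    · exact k.proj_comp z

/-- The fibrewise join of `h : Y → K` and `k : Z → K`: the homotopy pushout of the projections of
the homotopy pullback. -/
def fibJoin (h : FibMap Y K) (k : FibMap Z K) : FibSpace B :=
  hPushout (hPullbackFst h k) (hPullbackSnd h k)

/-- The induced map from the fibrewise join to `K`. -/
def fibJoinMap (h : FibMap Y K) (k : FibMap Z K) : FibMap (fibJoin h k) K :=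
  coWhisker (hPullbackFst h k) (hPullbackSnd h k) h k (hPullbackHomotopy h k)
    (hPullbackHomotopy_isFibHomotopy h k)

end Join

variable {E X : FibSpace B}

/-- The fibrewise sectional `n`-fat wedge `T^n_B(f)` together with the map `j_n`:
`j_0 = f`, and `j_{n+1}` is the join map of `f ×_B id : E ×_B ∏ X → ∏ X` and
`id ×_B j_n : X ×_B T^n_B(f) → ∏ X`. -/
def fatWedgeAux (f : FibMap E X) : (n : ℕ) → Σ T : FibSpace B, FibMap T (X.power n)
  | 0 => ⟨E, f⟩
  | n + 1 =>
    let h : FibMap (E.prod (X.power n)) (X.power (n + 1)) :=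
      f.prodMap (FibMap.id (X.power n))
    let k : FibMap (X.prod (fatWedgeAux f n).1) (X.power (n + 1)) :=
      (FibMap.id X).prodMap (fatWedgeAux f n).2
    ⟨fibJoin h k, fibJoinMap h k⟩

/-- The space `T^n_B(f)`. -/
def fatWedge (f : FibMap E X) (n : ℕ) : FibSpace B := (fatWedgeAux f n).1

/-- The map `j_n : T^n_B(f) → ∏_B^{n+1} X`. -/
def fatWedgeMap (f : FibMap E X) (n : ℕ) : FibMap (fatWedge f n) (X.power n) :=
  (fatWedgeAux f n).2

/-- The space `G^n_B(f)` together with the map `p_n`: `p_0 = f`, and `p_{n+1}` is the join map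
of `p_n` and `f`. -/
def ganeaAux (f : FibMap E X) : (n : ℕ) → Σ G : FibSpace B, FibMap G X
  | 0 => ⟨E, f⟩
  | n + 1 => ⟨fibJoin (ganeaAux f n).2 f, fibJoinMap (ganeaAux f n).2 f⟩

/-- The space `G^n_B(f)`. -/
def ganea (f : FibMap E X) (n : ℕ) : FibSpace B := (ganeaAux f n).1

/-- The `n`-th fibrewise Ganea map `p_n : G^n_B(f) → X`. -/
def ganeaMap (f : FibMap E X) (n : ℕ) : FibMap (ganea f n) X := (ganeaAux f n).2

/-- A subspace of a fibrewise space. -/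
def FibSpace.restrict (X : FibSpace B) (U : Set X) : FibSpace B where
  carrier := U
  proj := X.proj.comp ⟨Subtype.val, continuous_subtype_val⟩

def FibSpace.incl (X : FibSpace B) (U : Set X) : FibMap (X.restrict U) X where
  toMap := ⟨Subtype.val, continuous_subtype_val⟩
  proj_comp := fun _ => rfl

/-- `U` is an open subset of `X` on which `f` has a section up to fibrewise homotopy. -/
def IsFibSectional (f : FibMap E X) (U : Set X) : Prop :=
  IsOpen U ∧ ∃ s : FibMap (X.restrict U) E, FibHomotopic (X.incl U) (f.comp s)

/-- The fibrewise sectional category of `f`: the least `n` such that `X` is covered by `n + 1`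
fibrewise sectional open subsets, and `⊤` if there is none. -/
noncomputable def secatB (f : FibMap E X) : ℕ∞ :=
  sInf {m : ℕ∞ | ∃ n : ℕ, m = n ∧ ∃ U : Fin (n + 1) → Set X,
    (∀ i, IsFibSectional f (U i)) ∧ ⋃ i, U i = univ}

/-- `p : E → X` has a fibrewise homotopy section. -/
def HasFibHomotopySection (p : FibMap E X) : Prop :=
  ∃ s : FibMap X E, FibHomotopic (p.comp s) (FibMap.id X)

end Basic

/-! ### Gluing continuous maps and descending them to open subsets of quotients -/

section Gluing

/-! A map `g : W → K` lifts through the join of `h` and `k` up to fibrewise homotopy when some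
continuous `u : W → ℝ` has lifts of `g` through `h` on a set containing `{u < 1}` and through `k` on
a set containing `{0 < u}` (`HasHLift.join`). Conversely, the join coordinate of a lift splits `W`
into two such open sets (`HasHLift.exists_isOpen_of_join`).

Both `p_n` and `j_n` are iterated joins, so induction on `n` turns a lift through either into an
open cover by `n + 1` sets with lifts through `f`, and turns a partition of unity with such lifts on
its positivity sets back into a lift. For `j_n` the `i`-th set lifts the `i`-th coordinate of `g`;
for the diagonal every coordinate is the identity, so `j_n` and `p_n` give the same condition.
Normality of `X` provides the partition of unity subordinate to a sectional cover. -/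

theorem exists_continuousMap_glue {W T : Type*} [TopologicalSpace W] [TopologicalSpace T]
    {A M C : Set W} (hA : IsOpen A) (hM : IsOpen M) (hC : IsOpen C)
    (hcov : ∀ w, w ∈ A ∨ w ∈ M ∨ w ∈ C) (hAC : ∀ w, w ∈ A → w ∉ C)
    (a : C(A, T)) (m : C(M, T)) (c : C(C, T))
    (ham : ∀ w (h : w ∈ A) (h' : w ∈ M), a ⟨w, h⟩ = m ⟨w, h'⟩)
    (hcm : ∀ w (h : w ∈ C) (h' : w ∈ M), c ⟨w, h⟩ = m ⟨w, h'⟩) :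
    ∃ F : C(W, T), (∀ x : A, F x = a x) ∧ (∀ x : M, F x = m x) ∧ ∀ x : C, F x = c x := by
  classical
  let F : W → T := fun w =>
    if h : w ∈ A then a ⟨w, h⟩ else if h : w ∈ C then c ⟨w, h⟩ else
      m ⟨w, ((hcov w).resolve_left ‹_›).resolve_right ‹_›⟩
  have hFa : ∀ x : A, F x = a x := fun x => by simp [F]
  have hFc : ∀ x : C, F x = c x := fun x => by
    have : (x : W) ∉ A := fun h => hAC _ h x.2
    simp [F, this]
  have hFm : ∀ x : M, F x = m x := fun x => by
    by_cases h : (x : W) ∈ A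
    · simpa [F, h] using ham x h x.2
    · by_cases h' : (x : W) ∈ C
      · simpa [F, h, h'] using hcm x h' x.2
      · simp [F, h, h']
  have key : ∀ {S : Set W}, IsOpen S → ∀ s : C(S, T), (∀ x : S, F x = s x) →
      ∀ w ∈ S, ContinuousAt F w := fun {S} hS s hs w hw => by
    have : ContinuousOn F S := by
      rw [continuousOn_iff_continuous_domRestrict]
      exact s.continuous.congr fun x => (hs x).symm
    exact this.continuousAt (hS.mem_nhds hw)
  refine ⟨⟨F, continuous_iff_continuousAt.2 fun w => ?_⟩, hFa, hFm, hFc⟩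
  rcases hcov w with h | h | h
  exacts [key hA a hFa w h, key hM m hFm w h, key hC c hFc w h]

/-- A continuous map which is compatible with a relation over an open subset of the quotient
descends to that subset. -/
theorem exists_continuousMap_quot_restrict {α T : Type*} [TopologicalSpace α]
    [TopologicalSpace T] {r : α → α → Prop} {U : Set (Quot r)} (hU : IsOpen U) {F : α → T}
    (hF : Continuous F) (hr : ∀ a b, r a b → Quot.mk r a ∈ U → F a = F b) :
    ∃ G : C(U, T), ∀ a (h : Quot.mk r a ∈ U), G ⟨Quot.mk r a, h⟩ = F a := by
  -- `F` respects `r` only over `U`, so it descends as a partial function with domain `U`.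
  let P : Quot r → Part T := Quot.lift (fun a => ⟨Quot.mk r a ∈ U, fun _ => F a⟩) (by
    intro a b hab
    refine Part.ext' (by rw [Quot.sound hab]) fun h _ => hr a b hab h)
  have hP : ∀ q : Quot r, q ∈ U → (P q).Dom := by
    rintro ⟨a⟩ h
    exact h
  refine ⟨⟨fun q => (P q).get (hP q q.2), ?_⟩, fun a h => rfl⟩
  -- Openness of `U` matters here: a quotient map restricted over an open set is again a quotient
  -- map.
  have hq := (isQuotientMap_quot_mk (r := r)).restrictPreimage_isOpen hU
  rw [hq.continuous_iff]
  exact hF.comp continuous_subtype_val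

end Gluing

/-! ### Fibrewise homotopies and lifts up to homotopy -/

section

variable {B : Type u} [TopologicalSpace B]

theorem FibHomotopic.refl {X Y : FibSpace B} (f : FibMap X Y) : FibHomotopic f f :=
  ⟨⟨f.toMap.comp ContinuousMap.fst, fun x => f.proj_comp x.1⟩, fun _ => rfl, fun _ => rfl⟩

theorem FibHomotopic.symm {X Y : FibSpace B} {f g : FibMap X Y} (h : FibHomotopic f g) :
    FibHomotopic g f := by
  obtain ⟨H, h0, h1⟩ := h
  refine ⟨⟨⟨fun w => H (w.1, σ w.2), ?_⟩, fun w => H.proj_comp (w.1, σ w.2)⟩, ?_, ?_⟩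
  · exact H.continuous.comp (continuous_fst.prodMk (continuous_symm.comp continuous_snd))
  · intro x
    change H (x, σ 0) = _
    rw [symm_zero, h1]
  · intro x
    change H (x, σ 1) = _
    rw [symm_one, h0]

theorem FibHomotopic.trans {X Y : FibSpace B} {f g k : FibMap X Y} (h : FibHomotopic f g)
    (h' : FibHomotopic g k) : FibHomotopic f k := by
  obtain ⟨H, h0, h1⟩ := h
  obtain ⟨G, g0, g1⟩ := h'
  let H' : ContinuousMap.Homotopy f.toMap g.toMap :=
    { toFun := fun w => H (w.2, w.1)
      continuous_toFun := H.continuous.comp continuous_swap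
      map_zero_left := h0
      map_one_left := h1 }
  let G' : ContinuousMap.Homotopy g.toMap k.toMap :=
    { toFun := fun w => G (w.2, w.1)
      continuous_toFun := G.continuous.comp continuous_swap
      map_zero_left := g0
      map_one_left := g1 }
  refine ⟨⟨⟨fun w => H'.trans G' (w.2, w.1), ?_⟩, fun w => ?_⟩, ?_, ?_⟩
  · exact (H'.trans G').continuous.comp continuous_swap
  · change Y.proj (H'.trans G' (w.2, w.1)) = _
    rw [ContinuousMap.Homotopy.trans_apply]
    split_ifs
    · exact H.proj_comp _
    · exact G.proj_comp _
  · exact fun x => (H'.trans G').apply_zero x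
  · exact fun x => (H'.trans G').apply_one x

theorem FibHomotopic.precomp {W X Y : FibSpace B} {f g : FibMap X Y} (h : FibHomotopic f g)
    (c : FibMap W X) : FibHomotopic (f.comp c) (g.comp c) := by
  obtain ⟨H, h0, h1⟩ := h
  exact ⟨H.comp c.cyl, fun x => h0 (c x), fun x => h1 (c x)⟩

theorem FibHomotopic.postcomp {W X Y : FibSpace B} {f g : FibMap W X} (h : FibHomotopic f g)
    (c : FibMap X Y) : FibHomotopic (c.comp f) (c.comp g) := by
  obtain ⟨H, h0, h1⟩ := h
  exact ⟨c.comp H, fun x => congrArg c (h0 x), fun x => congrArg c (h1 x)⟩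

/-- `g` lifts through `p` up to fibrewise homotopy. -/
def HasHLift {W E X : FibSpace B} (p : FibMap E X) (g : FibMap W X) : Prop :=
  ∃ s : FibMap W E, FibHomotopic (p.comp s) g

theorem HasHLift.precomp {W W' E X : FibSpace B} {p : FibMap E X} {g : FibMap W X}
    (h : HasHLift p g) (c : FibMap W' W) : HasHLift p (g.comp c) := by
  obtain ⟨s, hs⟩ := h
  exact ⟨s.comp c, hs.precomp c⟩

theorem HasHLift.of_homotopic {W E X : FibSpace B} {p : FibMap E X} {g g' : FibMap W X}
    (h : HasHLift p g) (h' : FibHomotopic g g') : HasHLift p g' := by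
  obtain ⟨s, hs⟩ := h
  exact ⟨s, hs.trans h'⟩

/-- A fibrewise map with values in a subset, as a map into the subspace. -/
def FibMap.codRestrict {W X : FibSpace B} (c : FibMap W X) (U : Set X) (h : ∀ w, c w ∈ U) :
    FibMap W (X.restrict U) where
  toMap := ⟨fun w => ⟨c w, h w⟩, c.continuous.subtype_mk h⟩
  proj_comp := c.proj_comp

/-- `g` lifts through `p` up to fibrewise homotopy on the subspace `U`. -/
abbrev HasHLiftOn {W E X : FibSpace B} (p : FibMap E X) (g : FibMap W X) (U : Set W) : Prop :=
  HasHLift p (g.comp (W.incl U))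

theorem HasHLiftOn.comp {W W' E X : FibSpace B} {p : FibMap E X} {g : FibMap W X} {U : Set W}
    (h : HasHLiftOn p g U) (c : FibMap W' W) (hc : ∀ w, c w ∈ U) : HasHLift p (g.comp c) :=
  HasHLift.precomp h (c.codRestrict U hc)

theorem HasHLiftOn.image {W E X : FibSpace B} {p : FibMap E X} {g : FibMap W X} {V : Set W}
    {U : Set (W.restrict V)} (h : HasHLiftOn p (g.comp (W.incl V)) U) :
    HasHLiftOn p g (W.incl V '' U) := by
  have hV : ∀ w : W.restrict (W.incl V '' U), w.1 ∈ V := by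
    rintro ⟨_, w, _, rfl⟩
    exact w.2
  refine h.comp ((W.incl (W.incl V '' U)).codRestrict V hV) ?_
  rintro ⟨_, w, hw, rfl⟩
  exact hw

/-! ### Lifting through a fibrewise join -/

section Join

variable {W Y Z K : FibSpace B} {h : FibMap Y K} {k : FibMap Z K} {g : FibMap W K}

/-- A homotopy presented as a map into `C(I, K)` is a map out of `W` alone, so it can be glued or
descended from a quotient just like the lift itself, without treating `W × I` as a quotient. -/
theorem HasHLift.of_path {p : FibMap Y K} (s : FibMap W Y) (γ : C(W, C(I, K)))
    (hγ : ∀ w t, K.proj (γ w t) = W.proj w) (h0 : ∀ w, γ w 0 = p (s w))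
    (h1 : ∀ w, γ w 1 = g w) : HasHLift p g := by
  refine ⟨s, ⟨⟨fun w => γ w.1 w.2, ?_⟩, fun w => hγ w.1 w.2⟩, h0, h1⟩
  exact ContinuousEval.continuous_eval.comp
    ((γ.continuous.comp continuous_fst).prodMk continuous_snd)

/-- The coordinate in `I` on the fibrewise join. -/
def joinHeight (h : FibMap Y K) (k : FibMap Z K) : C(fibJoin h k, I) where
  toFun := Quot.lift (Sum.elim (fun _ => 0) (Sum.elim Prod.snd fun _ => 1)) (by
    rintro _ _ (x | x) <;> rfl)
  continuous_toFun := continuous_quot_lift _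
    (continuous_const.sumElim (continuous_snd.sumElim continuous_const))

/-- Away from the `Z` end, `(ℓ, t)` retracts to the `Y`-component of `ℓ`; the homotopy `r ↦ θ (t *
r)` runs from `θ 0 = h y` to the join map's value `θ t`. -/
theorem hasHLiftOn_joinHeight_lt_one (h : FibMap Y K) (k : FibMap Z K) :
    HasHLiftOn h (fibJoinMap h k) {q | joinHeight h k q < 1} := by
  set U : Set (fibJoin h k) := {q | joinHeight h k q < 1}
  have hU : IsOpen U := isOpen_lt (joinHeight h k).continuous continuous_const
  obtain ⟨r, hr⟩ : ∃ r : C(U, Y), (∀ y hy, r ⟨Quot.mk _ (.inl y), hy⟩ = y) ∧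
      ∀ x hx, r ⟨Quot.mk _ (.inr (.inl x)), hx⟩ = hPullbackFst h k x.1 := by
    -- The map to descend must also be defined on the `Z` summand, which misses `U`; `y₀` is a dummy
    -- value there. If `Y` is empty, so are the homotopy pullback and `U`.
    rcases isEmpty_or_nonempty Y with hY | ⟨⟨y₀⟩⟩
    · have : IsEmpty U := ⟨by
        rintro ⟨⟨y | x | z⟩, hq⟩
        · exact hY.elim y
        · exact hY.elim (hPullbackFst h k x.1)
        · exact (lt_irrefl (1 : I) hq).elim⟩
      exact ⟨⟨isEmptyElim, continuous_of_const fun x => this.elim x⟩,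
        fun y => hY.elim y, fun x => hY.elim (hPullbackFst h k x.1)⟩
    · obtain ⟨r, hr⟩ := exists_continuousMap_quot_restrict hU
        (F := Sum.elim (fun y => y) (Sum.elim (fun x => hPullbackFst h k x.1) fun _ => y₀))
        (continuous_id.sumElim (((hPullbackFst h k).continuous.comp
          continuous_fst).sumElim continuous_const)) (by
          rintro _ _ (x | x) hx
          · rfl
          · exact (lt_irrefl (1 : I) hx).elim)
      exact ⟨r, fun y hy => hr _ hy, fun x hx => hr _ hx⟩
  have hc : Continuous fun x : (hPullback h k).cyl × I =>
      hPullbackHomotopy h k (x.1.1, x.1.2 * x.2) :=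
    (hPullbackHomotopy h k).continuous.comp ((continuous_fst.comp continuous_fst).prodMk
      ((continuous_snd.comp continuous_fst).mul continuous_snd))
  obtain ⟨γ, hγ⟩ := exists_continuousMap_quot_restrict hU
    (F := Sum.elim (fun y => ContinuousMap.const I (h y)) (Sum.elim
      (ContinuousMap.curry ⟨_, hc⟩) fun z => ContinuousMap.const I (k z)))
    ((ContinuousMap.continuous_const'.comp h.continuous).sumElim
      ((ContinuousMap.continuous _).sumElim
        (ContinuousMap.continuous_const'.comp k.continuous))) (by
      rintro _ _ (x | x) hx
      · ext t
        change hPullbackHomotopy h k (x, 0 * t) = h (hPullbackFst h k x)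
        rw [zero_mul]
        exact (hPullbackHomotopy_isFibHomotopy h k).1 x
      · exact (lt_irrefl (1 : I) hx).elim)
  refine HasHLift.of_path ⟨r, ?_⟩ γ ?_ ?_ ?_
  · rintro ⟨⟨y | x | z⟩, hq⟩
    · exact congrArg Y.proj (hr.1 y hq)
    · exact (congrArg Y.proj (hr.2 x hq)).trans ((hPullbackFst h k).proj_comp x.1)
    · exact (lt_irrefl (1 : I) hq).elim
  · rintro ⟨⟨y | x | z⟩, hq⟩ t
    · refine (congrArg K.proj (DFunLike.congr_fun (hγ _ hq) t)).trans ?_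
      exact h.proj_comp y
    · refine (congrArg K.proj (DFunLike.congr_fun (hγ _ hq) t)).trans ?_
      exact (hPullbackHomotopy h k).proj_comp _
    · exact (lt_irrefl (1 : I) hq).elim
  · rintro ⟨⟨y | x | z⟩, hq⟩
    · refine (DFunLike.congr_fun (hγ _ hq) 0).trans ?_
      exact congrArg h (hr.1 y hq).symm
    · refine (DFunLike.congr_fun (hγ _ hq) 0).trans ?_
      refine Eq.trans ?_ (congrArg h (hr.2 x hq).symm)
      change hPullbackHomotopy h k (x.1, x.2 * 0) = _
      rw [mul_zero]
      exact (hPullbackHomotopy_isFibHomotopy h k).1 x.1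
    · exact (lt_irrefl (1 : I) hq).elim
  · rintro ⟨⟨y | x | z⟩, hq⟩
    · refine (DFunLike.congr_fun (hγ _ hq) 1).trans ?_
      rfl
    · refine (DFunLike.congr_fun (hγ _ hq) 1).trans ?_
      change hPullbackHomotopy h k (x.1, x.2 * 1) = hPullbackHomotopy h k x
      rw [mul_one]
      rfl
    · exact (lt_irrefl (1 : I) hq).elim

/-- Mirror image at the `Z` end: `r ↦ θ (1 - (1 - t) * r)` runs from `θ 1 = k z` to `θ t`. -/
theorem hasHLiftOn_joinHeight_pos (h : FibMap Y K) (k : FibMap Z K) :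
    HasHLiftOn k (fibJoinMap h k) {q | 0 < joinHeight h k q} := by
  set U : Set (fibJoin h k) := {q | 0 < joinHeight h k q}
  have hU : IsOpen U := isOpen_lt continuous_const (joinHeight h k).continuous
  obtain ⟨r, hr⟩ : ∃ r : C(U, Z), (∀ z hz, r ⟨Quot.mk _ (.inr (.inr z)), hz⟩ = z) ∧
      ∀ x hx, r ⟨Quot.mk _ (.inr (.inl x)), hx⟩ = hPullbackSnd h k x.1 := by
    rcases isEmpty_or_nonempty Z with hZ | ⟨⟨z₀⟩⟩
    · have : IsEmpty U := ⟨by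
        rintro ⟨⟨y | x | z⟩, hq⟩
        · exact (lt_irrefl (0 : I) hq).elim
        · exact hZ.elim (hPullbackSnd h k x.1)
        · exact hZ.elim z⟩
      exact ⟨⟨isEmptyElim, continuous_of_const fun x => this.elim x⟩,
        fun z => hZ.elim z, fun x => hZ.elim (hPullbackSnd h k x.1)⟩
    · obtain ⟨r, hr⟩ := exists_continuousMap_quot_restrict hU
        (F := Sum.elim (fun _ => z₀) (Sum.elim (fun x => hPullbackSnd h k x.1) fun z => z))
        (continuous_const.sumElim (((hPullbackSnd h k).continuous.comp
          continuous_fst).sumElim continuous_id)) (by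
          rintro _ _ (x | x) hx
          · exact (lt_irrefl (0 : I) hx).elim
          · rfl)
      exact ⟨r, fun z hz => hr _ hz, fun x hx => hr _ hx⟩
  have hc : Continuous fun x : (hPullback h k).cyl × I =>
      hPullbackHomotopy h k (x.1.1, σ (σ x.1.2 * x.2)) :=
    (hPullbackHomotopy h k).continuous.comp ((continuous_fst.comp continuous_fst).prodMk
      (continuous_symm.comp ((continuous_symm.comp
        (continuous_snd.comp continuous_fst)).mul continuous_snd)))
  obtain ⟨γ, hγ⟩ := exists_continuousMap_quot_restrict hU
    (F := Sum.elim (fun y => ContinuousMap.const I (h y)) (Sum.elim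
      (ContinuousMap.curry ⟨_, hc⟩) fun z => ContinuousMap.const I (k z)))
    ((ContinuousMap.continuous_const'.comp h.continuous).sumElim
      ((ContinuousMap.continuous _).sumElim
        (ContinuousMap.continuous_const'.comp k.continuous))) (by
      rintro _ _ (x | x) hx
      · exact (lt_irrefl (0 : I) hx).elim
      · ext t
        change hPullbackHomotopy h k (x, σ (σ 1 * t)) = k (hPullbackSnd h k x)
        rw [symm_one, zero_mul, symm_zero]
        exact (hPullbackHomotopy_isFibHomotopy h k).2 x)
  refine HasHLift.of_path ⟨r, ?_⟩ γ ?_ ?_ ?_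
  · rintro ⟨⟨y | x | z⟩, hq⟩
    · exact (lt_irrefl (0 : I) hq).elim
    · exact (congrArg Z.proj (hr.2 x hq)).trans ((hPullbackSnd h k).proj_comp x.1)
    · exact congrArg Z.proj (hr.1 z hq)
  · rintro ⟨⟨y | x | z⟩, hq⟩ t
    · exact (lt_irrefl (0 : I) hq).elim
    · refine (congrArg K.proj (DFunLike.congr_fun (hγ _ hq) t)).trans ?_
      exact (hPullbackHomotopy h k).proj_comp _
    · refine (congrArg K.proj (DFunLike.congr_fun (hγ _ hq) t)).trans ?_
      exact k.proj_comp z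
  · rintro ⟨⟨y | x | z⟩, hq⟩
    · exact (lt_irrefl (0 : I) hq).elim
    · refine (DFunLike.congr_fun (hγ _ hq) 0).trans ?_
      refine Eq.trans ?_ (congrArg k (hr.2 x hq).symm)
      change hPullbackHomotopy h k (x.1, σ (σ x.2 * 0)) = _
      rw [mul_zero, symm_zero]
      exact (hPullbackHomotopy_isFibHomotopy h k).2 x.1
    · refine (DFunLike.congr_fun (hγ _ hq) 0).trans ?_
      exact congrArg k (hr.1 z hq).symm
  · rintro ⟨⟨y | x | z⟩, hq⟩
    · exact (lt_irrefl (0 : I) hq).elim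
    · refine (DFunLike.congr_fun (hγ _ hq) 1).trans ?_
      change hPullbackHomotopy h k (x.1, σ (σ x.2 * 1)) = hPullbackHomotopy h k x
      rw [mul_one, symm_symm]
      rfl
    · refine (DFunLike.congr_fun (hγ _ hq) 1).trans ?_
      rfl

/-- A homotopy lift to a fibrewise join splits the source into two open sets with homotopy lifts
to the two factors. -/
theorem HasHLift.exists_isOpen_of_join (H : HasHLift (fibJoinMap h k) g) :
    ∃ U V : Set W, IsOpen U ∧ IsOpen V ∧ U ∪ V = univ ∧ HasHLiftOn h g U ∧ HasHLiftOn k g V := by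
  obtain ⟨s, hs⟩ := H
  have hc : Continuous fun w => joinHeight h k (s w) :=
    (joinHeight h k).continuous.comp s.continuous
  refine ⟨{w | joinHeight h k (s w) < 1}, {w | 0 < joinHeight h k (s w)},
    isOpen_lt hc continuous_const, isOpen_lt continuous_const hc, ?_, ?_, ?_⟩
  · refine eq_univ_of_forall fun w => ?_
    by_cases hw : joinHeight h k (s w) < 1
    · exact Or.inl hw
    · exact Or.inr (zero_lt_one.trans_le (not_lt.1 hw))
  · exact ((hasHLiftOn_joinHeight_lt_one h k).comp (s.comp (W.incl _))
      fun w => w.2).of_homotopic (hs.precomp (W.incl _))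
  · exact ((hasHLiftOn_joinHeight_pos h k).comp (s.comp (W.incl _))
      fun w => w.2).of_homotopic (hs.precomp (W.incl _))

/-- Homotopy lifts to the two factors over the sets `{u < 1}` and `{0 < u}` combine to a homotopy
lift to the fibrewise join. -/
theorem HasHLift.join {U V : Set W} (u : C(W, ℝ)) (hU : ∀ w, u w < 1 → w ∈ U)
    (hV : ∀ w, 0 < u w → w ∈ V) (HU : HasHLiftOn h g U) (HV : HasHLiftOn k g V) :
    HasHLift (fibJoinMap h k) g := by
  obtain ⟨s, H, H0, H1⟩ := HU
  obtain ⟨t, G, G0, G1⟩ := HV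
  -- On `A` only the lift `s` is used, on `C` only `t`, and on `M` both are defined. `A` and `C` are
  -- disjoint, so agreement is needed only on their overlaps with `M`.
  set A : Set W := {w | u w < 1 / 4}
  set M : Set W := {w | 0 < u w ∧ u w < 1}
  set C : Set W := {w | 3 / 4 < u w}
  have hAU : ∀ w ∈ A, w ∈ U := fun w (hw : u w < 1 / 4) => hU w (by linarith)
  have hCV : ∀ w ∈ C, w ∈ V := fun w (hw : 3 / 4 < u w) => hV w (by linarith)
  let iA : C(A, W.restrict U) := ⟨fun w => ⟨w, hAU w w.2⟩, continuous_subtype_val.subtype_mk _⟩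
  let iC : C(C, W.restrict V) := ⟨fun w => ⟨w, hCV w w.2⟩, continuous_subtype_val.subtype_mk _⟩
  let iU : C(M, W.restrict U) :=
    ⟨fun w => ⟨w, hU w w.2.2⟩, continuous_subtype_val.subtype_mk _⟩
  let iV : C(M, W.restrict V) :=
    ⟨fun w => ⟨w, hV w w.2.1⟩, continuous_subtype_val.subtype_mk _⟩
  let pI : C(ℝ, I) := ⟨projIcc 0 1 zero_le_one, continuous_projIcc⟩
  have pI_zero : ∀ r ≤ 0, pI r = 0 := fun r hr => projIcc_of_le_left zero_le_one hr
  have pI_one : ∀ r, 1 ≤ r → pI r = 1 := fun r hr => projIcc_of_right_le zero_le_one hr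
  -- `H` followed by the reverse of `G`: a path from `h (s w)` to `k (t w)` through `g w` at time `1
  -- / 2`. It supplies the path component of the point `ℓ w` of the homotopy pullback.
  let Θ : C(M × ℝ, K) :=
    { toFun := fun w => if w.2 ≤ 1 / 2 then H (iU w.1, pI (2 * w.2)) else
        G (iV w.1, pI (2 - 2 * w.2))
      continuous_toFun := by
        refine Continuous.if_le ?_ ?_ continuous_snd continuous_const ?_
        · exact H.continuous.comp ((iU.continuous.comp continuous_fst).prodMk
            (pI.continuous.comp (by fun_prop)))
        · exact G.continuous.comp ((iV.continuous.comp continuous_fst).prodMk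
            (pI.continuous.comp (by fun_prop)))
        · rintro ⟨w, r⟩ hr
          have e1 : pI (2 * r) = 1 := pI_one _ (by linarith [show r = 1 / 2 from hr])
          have e2 : pI (2 - 2 * r) = 1 := pI_one _ (by linarith [show r = 1 / 2 from hr])
          change H (iU w, pI (2 * r)) = G (iV w, pI (2 - 2 * r))
          rw [e1, e2]
          exact (H1 _).trans (G1 (iV w)).symm }
  have Θ_of_le : ∀ (w : M) (r : ℝ), r ≤ 1 / 2 → Θ (w, r) = H (iU w, pI (2 * r)) :=
    fun w r hr => if_pos hr
  have Θ_of_ge : ∀ (w : M) (r : ℝ), 1 / 2 ≤ r → Θ (w, r) = G (iV w, pI (2 - 2 * r)) := by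
    intro w r hr
    rcases hr.eq_or_lt with rfl | hr
    · rw [Θ_of_le w _ le_rfl]
      have e1 : pI (2 * (1 / 2)) = 1 := pI_one _ (by norm_num)
      have e2 : pI (2 - 2 * (1 / 2)) = 1 := pI_one _ (by norm_num)
      rw [e1, e2]
      exact (H1 _).trans (G1 (iV w)).symm
    · exact if_neg hr.not_ge
  have Θ_proj : ∀ w r, K.proj (Θ (w, r)) = W.proj w := by
    intro w r
    rcases le_total r (1 / 2) with hr | hr
    · rw [Θ_of_le w r hr]
      exact H.proj_comp _
    · rw [Θ_of_ge w r hr]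
      exact G.proj_comp _
  have Θ_zero : ∀ w, Θ (w, 0) = h (s (iU w)) := by
    intro w
    rw [Θ_of_le w 0 (by norm_num)]
    have e : pI (2 * 0) = 0 := pI_zero _ (by norm_num)
    rw [e]
    exact H0 _
  have Θ_one : ∀ w, Θ (w, 1) = k (t (iV w)) := by
    intro w
    rw [Θ_of_ge w 1 (by norm_num)]
    have e : pI (2 - 2 * 1) = 0 := pI_zero _ (by norm_num)
    rw [e]
    exact G0 _
  have Θ_half : ∀ w, Θ (w, 1 / 2) = g w := by
    intro w
    rw [Θ_of_le w _ le_rfl]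
    have e : pI (2 * (1 / 2)) = 1 := pI_one _ (by norm_num)
    rw [e]
    exact H1 _
  let θ : C(M, C(I, K)) := ContinuousMap.curry
    (Θ.comp ((ContinuousMap.id M).prodMap ⟨Subtype.val, continuous_subtype_val⟩))
  let ℓ : C(M, hPullback h k) :=
    ⟨fun w => ⟨(s (iU w), ⟨(W.proj w, θ w), fun r => Θ_proj w r⟩, t (iV w)),
      (Θ_zero w).symm, (Θ_one w).symm⟩, by
      refine Continuous.subtype_mk ?_ _
      refine (s.continuous.comp iU.continuous).prodMk (Continuous.prodMk ?_
        (t.continuous.comp iV.continuous))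
      exact ((W.proj.continuous.comp continuous_subtype_val).prodMk
        θ.continuous).subtype_mk _⟩
  -- Clamping `2 * u - 1 / 2` gives a join coordinate equal to `0` on `A` and `1` on `C`, where the
  -- join relations identify the cylinder point with `s w` or `t w`.
  let v : C(W, I) := pI.comp ⟨fun w => 2 * u w - 1 / 2, by fun_prop⟩
  have v_A : ∀ w ∈ A, v w = 0 := fun w (hw : u w < 1 / 4) =>
    pI_zero _ (by change 2 * u w - 1 / 2 ≤ 0; linarith)
  have v_C : ∀ w ∈ C, v w = 1 := fun w (hw : 3 / 4 < u w) =>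
    pI_one _ (by change 1 ≤ 2 * u w - 1 / 2; linarith)
  let mk : C(Y ⊕ ((hPullback h k).cyl ⊕ Z), fibJoin h k) := ⟨Quot.mk _, continuous_quot_mk⟩
  -- The lift and its homotopy are glued together, as one map into the product of the join and `C(I,
  -- K)`.
  let FA : C(A, fibJoin h k × C(I, K)) :=
    ContinuousMap.prodMk (mk.comp ⟨fun w => .inl (s (iA w)),
      continuous_inl.comp (s.continuous.comp iA.continuous)⟩)
      (ContinuousMap.comp ⟨_, (ContinuousMap.curry H.toMap).continuous⟩ iA)
  let FC : C(C, fibJoin h k × C(I, K)) :=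
    ContinuousMap.prodMk (mk.comp ⟨fun w => .inr (.inr (t (iC w))),
      continuous_inr.comp (continuous_inr.comp (t.continuous.comp iC.continuous))⟩)
      (ContinuousMap.comp ⟨_, (ContinuousMap.curry G.toMap).continuous⟩ iC)
  -- The homotopy moves the time linearly from `v w`, the join map's value, to `1 / 2`, the value `g
  -- w`. For `v w = 0` it traces `H`, and for `v w = 1` it traces `G`, as the gluing requires.
  let FM : C(M, fibJoin h k × C(I, K)) :=
    ContinuousMap.prodMk (mk.comp ⟨fun w => .inr (.inl (ℓ w, v w)),
      continuous_inr.comp (continuous_inl.comp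
        (ℓ.continuous.prodMk (v.continuous.comp continuous_subtype_val)))⟩)
      (ContinuousMap.curry (Θ.comp ⟨fun w => (w.1, (1 - (w.2 : ℝ)) * v w.1 + w.2 / 2),
        by fun_prop⟩))
  obtain ⟨F, hFA, hFM, hFC⟩ := exists_continuousMap_glue (A := A) (M := M) (C := C)
    (isOpen_lt u.continuous continuous_const)
    ((isOpen_lt continuous_const u.continuous).inter (isOpen_lt u.continuous continuous_const))
    (isOpen_lt continuous_const u.continuous)
    (fun w => by
      by_cases h1 : u w < 1 / 4
      · exact .inl h1
      · by_cases h2 : 3 / 4 < u w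
        · exact .inr (.inr h2)
        · exact .inr (.inl ⟨by linarith, by linarith⟩))
    (fun w (h1 : u w < 1 / 4) (h2 : 3 / 4 < u w) => by linarith) FA FM FC
    (fun w hw hw' => by
      refine Prod.ext ?_ (ContinuousMap.ext fun r => ?_)
      · change _ = mk (.inr (.inl (ℓ ⟨w, hw'⟩, v w)))
        rw [v_A w hw]
        exact (Quot.sound (HPushoutRel.zero (f := hPullbackFst h k) (g := hPullbackSnd h k)
          (ℓ ⟨w, hw'⟩))).symm
      · change H (iU ⟨w, hw'⟩, r) = Θ (⟨w, hw'⟩, (1 - (r : ℝ)) * v w + r / 2)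
        rw [v_A w hw, Θ_of_le _ _ (by simpa using by linarith [r.2.2])]
        have e : pI (2 * ((1 - (r : ℝ)) * (0 : I) + r / 2)) = r := by
          rw [show 2 * ((1 - (r : ℝ)) * (0 : I) + r / 2) = r by simp; ring]
          exact projIcc_val zero_le_one r
        rw [e])
    (fun w hw hw' => by
      refine Prod.ext ?_ (ContinuousMap.ext fun r => ?_)
      · change _ = mk (.inr (.inl (ℓ ⟨w, hw'⟩, v w)))
        rw [v_C w hw]
        exact (Quot.sound (HPushoutRel.one (f := hPullbackFst h k) (g := hPullbackSnd h k)
          (ℓ ⟨w, hw'⟩))).symm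
      · change G (iV ⟨w, hw'⟩, r) = Θ (⟨w, hw'⟩, (1 - (r : ℝ)) * v w + r / 2)
        rw [v_C w hw, Θ_of_ge _ _ (by simpa using by linarith [r.2.2])]
        have e : pI (2 - 2 * ((1 - (r : ℝ)) * (1 : I) + r / 2)) = r := by
          rw [show 2 - 2 * ((1 - (r : ℝ)) * (1 : I) + r / 2) = r by simp; ring]
          exact projIcc_val zero_le_one r
        rw [e])
  have key : ∀ w, ((∀ r, K.proj ((F w).2 r) = W.proj w) ∧
      (fibJoin h k).proj (F w).1 = W.proj w) ∧
      (F w).2 0 = fibJoinMap h k (F w).1 ∧ (F w).2 1 = g w := by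
    intro w
    by_cases h1 : u w < 1 / 4
    · rw [show F w = FA ⟨w, h1⟩ from hFA ⟨w, h1⟩]
      exact ⟨⟨fun r => H.proj_comp _, s.proj_comp _⟩, H0 _, H1 _⟩
    · by_cases h2 : 3 / 4 < u w
      · rw [show F w = FC ⟨w, h2⟩ from hFC ⟨w, h2⟩]
        exact ⟨⟨fun r => G.proj_comp _, t.proj_comp _⟩, G0 _, G1 _⟩
      · have hw : w ∈ M := ⟨by linarith, by linarith⟩
        rw [show F w = FM ⟨w, hw⟩ from hFM ⟨w, hw⟩]
        refine ⟨⟨fun r => Θ_proj _ _, rfl⟩, ?_, ?_⟩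
        · change Θ (⟨w, hw⟩, (1 - ((0 : I) : ℝ)) * v w + ((0 : I) : ℝ) / 2) =
            Θ (⟨w, hw⟩, v w)
          congr 2
          simp
        · change Θ (⟨w, hw⟩, (1 - ((1 : I) : ℝ)) * v w + ((1 : I) : ℝ) / 2) = _
          refine Eq.trans ?_ (Θ_half ⟨w, hw⟩)
          congr 2
          simp
  exact HasHLift.of_path ⟨ContinuousMap.fst.comp F, fun w => (key w).1.2⟩
    (ContinuousMap.snd.comp F) (fun w => (key w).1.1) (fun w => (key w).2.1) fun w => (key w).2.2

end Join

/-! ### Lifts into fibrewise products -/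

def FibSpace.prodFst (Y Z : FibSpace B) : FibMap (Y.prod Z) Y :=
  ⟨⟨fun p => p.1.1, continuous_fst.comp continuous_subtype_val⟩, fun _ => rfl⟩

def FibSpace.prodSnd (Y Z : FibSpace B) : FibMap (Y.prod Z) Z :=
  ⟨⟨fun p => p.1.2, continuous_snd.comp continuous_subtype_val⟩, fun p => p.2.symm⟩

theorem HasHLift.id {W X : FibSpace B} (g : FibMap W X) : HasHLift (FibMap.id X) g :=
  ⟨g, FibHomotopic.refl g⟩

section Prod

variable {W E X Z Y : FibSpace B} {f : FibMap E X} {k : FibMap Z Y} {g : FibMap W (X.prod Y)}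

theorem HasHLift.prodMap (hf : HasHLift f ((X.prodFst Y).comp g))
    (hk : HasHLift k ((X.prodSnd Y).comp g)) : HasHLift (f.prodMap k) g := by
  obtain ⟨s, H, H0, H1⟩ := hf
  obtain ⟨t, G, G0, G1⟩ := hk
  exact ⟨s.prodLift t, H.prodLift G, fun x => Subtype.ext (Prod.ext (H0 x) (G0 x)),
    fun x => Subtype.ext (Prod.ext (H1 x) (G1 x))⟩

theorem HasHLift.prodFst (h : HasHLift (f.prodMap k) g) :
    HasHLift f ((X.prodFst Y).comp g) := by
  obtain ⟨s, hs⟩ := h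
  exact ⟨(E.prodFst Z).comp s, hs.postcomp (X.prodFst Y)⟩

theorem HasHLift.prodSnd (h : HasHLift (f.prodMap k) g) :
    HasHLift k ((X.prodSnd Y).comp g) := by
  obtain ⟨s, hs⟩ := h
  exact ⟨(E.prodSnd Z).comp s, hs.postcomp (X.prodSnd Y)⟩

end Prod

/-- The coordinate projections of the iterated fibrewise product. -/
def FibSpace.coord (X : FibSpace B) : (n : ℕ) → Fin (n + 1) → FibMap (X.power n) X
  | 0, _ => FibMap.id X
  | n + 1, i => Fin.cases (X.prodFst (X.power n))
      (fun j => (X.coord n j).comp (X.prodSnd (X.power n))) i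

theorem FibSpace.coord_comp_diag (X : FibSpace B) :
    ∀ (n : ℕ) (i : Fin (n + 1)), (X.coord n i).comp (X.diag n) = FibMap.id X
  | 0, _ => rfl
  | n + 1, i => by
    refine Fin.cases rfl (fun j => ?_) i
    exact X.coord_comp_diag n j

/-! ### Covers, partitions of unity and the inductions on `n` -/

section Covers

/-- The predicate depends on the index because the fat wedge asks the `i`-th set to lift the `i`-th
coordinate. -/
theorem exists_isOpen_cover_cons {W : Type*} [TopologicalSpace W] {n : ℕ}
    {P : Fin (n + 2) → Set W → Prop} {U V : Set W} (hU : IsOpen U) (hV : IsOpen V)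
    (hUV : U ∪ V = univ) (hP : P 0 U) (U' : Fin (n + 1) → Set V)
    (hU' : ∀ i, IsOpen (U' i) ∧ P i.succ (Subtype.val '' U' i)) (hcov : ⋃ i, U' i = univ) :
    ∃ O : Fin (n + 2) → Set W, (∀ i, IsOpen (O i) ∧ P i (O i)) ∧ ⋃ i, O i = univ := by
  refine ⟨Fin.cons U fun i => Subtype.val '' U' i, fun i => ?_, eq_univ_of_forall fun w => ?_⟩
  · refine Fin.cases ⟨hU, hP⟩ (fun j => ?_) i
    exact ⟨hV.isOpenMap_subtype_val _ (hU' j).1, (hU' j).2⟩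
  · rcases hUV.ge (mem_univ w) with hw | hw
    · exact mem_iUnion.2 ⟨0, hw⟩
    · obtain ⟨i, hi⟩ := mem_iUnion.1 (hcov.ge (mem_univ (⟨w, hw⟩ : V)))
      exact mem_iUnion.2 ⟨i.succ, ⟨w, hw⟩, hi, rfl⟩

/-- Dividing by `1 - ρ 0` renormalises the remaining functions. Induction can thus pass to an open
subspace without requiring that subspace to be normal. -/
theorem exists_partition_tail {W : Type*} [TopologicalSpace W] {n : ℕ}
    (ρ : Fin (n + 2) → C(W, ℝ)) (h0 : ∀ i w, 0 ≤ ρ i w) (h1 : ∀ w, ∑ i, ρ i w = 1) :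
    ∃ τ : Fin (n + 1) → C({w | ρ 0 w < 1}, ℝ), (∀ i w, 0 ≤ τ i w) ∧ (∀ w, ∑ i, τ i w = 1) ∧
      ∀ i w, 0 < τ i w → 0 < ρ i.succ w := by
  have hpos : ∀ w : {w | ρ 0 w < 1}, 0 < 1 - ρ 0 w := fun w => sub_pos.2 w.2
  refine ⟨fun i => ⟨fun w => ρ i.succ w / (1 - ρ 0 w), ?_⟩, fun i w => ?_, fun w => ?_,
    fun i w hw => ?_⟩
  · exact ((ρ i.succ).continuous.comp continuous_subtype_val).div₀
      (continuous_const.sub ((ρ 0).continuous.comp continuous_subtype_val))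
      fun w => (hpos w).ne'
  · exact div_nonneg (h0 _ _) (hpos w).le
  · change ∑ i : Fin (n + 1), ρ i.succ w / (1 - ρ 0 w) = 1
    have := h1 w
    rw [Fin.sum_univ_succ] at this
    rw [← Finset.sum_div, div_eq_one_iff_eq (hpos w).ne']
    linarith
  · exact (div_pos_iff_of_pos_right (hpos w)).1 hw

variable {E X : FibSpace B} (f : FibMap E X)

/-- The source and `g` are arbitrary because the inductive step restricts `g` to an open subspace.
-/
theorem exists_cover_of_hasHLift_ganeaMap (n : ℕ) : ∀ {W : FibSpace B} {g : FibMap W X},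
    HasHLift (ganeaMap f n) g → ∃ U : Fin (n + 1) → Set W,
      (∀ i, IsOpen (U i) ∧ HasHLiftOn f g (U i)) ∧ ⋃ i, U i = univ := by
  induction n with
  | zero =>
    intro W g hg
    exact ⟨fun _ => univ, fun _ => ⟨isOpen_univ, hg.precomp _⟩, iUnion_const _⟩
  | succ n ih =>
    intro W g hg
    obtain ⟨V, U, hV, hU, hVU, HV, HU⟩ :=
      HasHLift.exists_isOpen_of_join (h := ganeaMap f n) (k := f) hg
    obtain ⟨U', hU', hcov⟩ := ih HV
    exact exists_isOpen_cover_cons (P := fun _ O => HasHLiftOn f g O) hU hV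
      ((union_comm _ _).trans hVU) HU U' (fun i => ⟨(hU' i).1, (hU' i).2.image⟩) hcov

/-- A lift through `f ×_B id` lifts coordinate `0` through `f`; a lift through `id ×_B j_n` lifts
the remaining coordinates through `j_n`, where induction applies. -/
theorem exists_cover_of_hasHLift_fatWedgeMap (n : ℕ) :
    ∀ {W : FibSpace B} {g : FibMap W (X.power n)},
    HasHLift (fatWedgeMap f n) g → ∃ U : Fin (n + 1) → Set W,
      (∀ i, IsOpen (U i) ∧ HasHLiftOn f ((X.coord n i).comp g) (U i)) ∧ ⋃ i, U i = univ := by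
  induction n with
  | zero =>
    intro W g hg
    exact ⟨fun _ => univ, fun _ => ⟨isOpen_univ, HasHLift.precomp hg _⟩, iUnion_const _⟩
  | succ n ih =>
    intro W g hg
    obtain ⟨U, V, hU, hV, hUV, HU, HV⟩ :=
      HasHLift.exists_isOpen_of_join (h := f.prodMap (FibMap.id (X.power n)))
        (k := (FibMap.id X).prodMap (fatWedgeMap f n)) hg
    obtain ⟨U', hU', hcov⟩ := ih HV.prodSnd
    exact exists_isOpen_cover_cons (P := fun i O => HasHLiftOn f ((X.coord (n + 1) i).comp g) O)
      hU hV hUV HU.prodFst U' (fun i => ⟨(hU' i).1,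
        HasHLiftOn.image (g := (X.coord (n + 1) i.succ).comp g) (hU' i).2⟩) hcov

theorem hasHLift_ganeaMap_of_partition (n : ℕ) : ∀ {W : FibSpace B} {g : FibMap W X}
    (ρ : Fin (n + 1) → C(W, ℝ)), (∀ i w, 0 ≤ ρ i w) → (∀ w, ∑ i, ρ i w = 1) →
    (∀ i, HasHLiftOn f g {w | 0 < ρ i w}) → HasHLift (ganeaMap f n) g := by
  induction n with
  | zero =>
    intro W g ρ _ h1 h
    exact (h 0).comp (FibMap.id W) fun w => by
      have : ρ 0 w = 1 := by simpa using h1 w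
      exact zero_lt_one.trans_eq this.symm
  | succ n ih =>
    intro W g ρ h0 h1 h
    obtain ⟨τ, t0, t1, hτ⟩ := exists_partition_tail ρ h0 h1
    refine HasHLift.join (h := ganeaMap f n) (k := f) (ρ 0) (fun w hw => hw) (fun w hw => hw)
      (ih τ t0 t1 fun i => ?_) (h 0)
    exact (h i.succ).comp ((W.incl _).comp ((W.restrict _).incl _)) fun w => hτ i w.1 w.2

theorem hasHLift_fatWedgeMap_of_partition (n : ℕ) :
    ∀ {W : FibSpace B} {g : FibMap W (X.power n)} (ρ : Fin (n + 1) → C(W, ℝ)),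
    (∀ i w, 0 ≤ ρ i w) → (∀ w, ∑ i, ρ i w = 1) →
    (∀ i, HasHLiftOn f ((X.coord n i).comp g) {w | 0 < ρ i w}) →
    HasHLift (fatWedgeMap f n) g := by
  induction n with
  | zero =>
    intro W g ρ _ h1 h
    exact (h 0).comp (FibMap.id W) fun w => by
      have : ρ 0 w = 1 := by simpa using h1 w
      exact zero_lt_one.trans_eq this.symm
  | succ n ih =>
    intro W g ρ h0 h1 h
    obtain ⟨τ, t0, t1, hτ⟩ := exists_partition_tail ρ h0 h1
    -- Here `f` sits in the first factor of the join, opposite to the Ganea construction, so the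
    -- separating function is `1 - ρ 0` rather than `ρ 0`.
    refine HasHLift.join (h := f.prodMap (FibMap.id (X.power n)))
      (k := (FibMap.id X).prodMap (fatWedgeMap f n)) (U := {w | 0 < ρ 0 w})
      (V := {w | ρ 0 w < 1}) ⟨fun w => 1 - ρ 0 w, by fun_prop⟩
      (fun w hw => ?_) (fun w hw => ?_)
      (HasHLift.prodMap (h 0) (HasHLift.id _))
      (HasHLift.prodMap (HasHLift.id _) (ih τ t0 t1 fun i => ?_))
    · exact sub_lt_self_iff 1 |>.1 hw
    · exact sub_pos.1 hw
    · exact (h i.succ).comp ((W.incl _).comp ((W.restrict _).incl _)) fun w => hτ i w.1 w.2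

variable {f}

theorem secatB_le_iff {n : ℕ} : secatB f ≤ n ↔
    ∃ U : Fin (n + 1) → Set X, (∀ i, IsFibSectional f (U i)) ∧ ⋃ i, U i = univ := by
  refine ⟨fun h => ?_, fun h => sInf_le ⟨n, rfl, h⟩⟩
  have hne : {m : ℕ∞ | ∃ n : ℕ, m = n ∧ ∃ U : Fin (n + 1) → Set X,
      (∀ i, IsFibSectional f (U i)) ∧ ⋃ i, U i = univ}.Nonempty := by
    by_contra hemp
    rw [not_nonempty_iff_eq_empty] at hemp
    rw [secatB, hemp, sInf_empty] at h
    exact absurd h (by simp)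
  obtain ⟨m, hm, U, hU, hcov⟩ := csInf_mem hne
  have hmn : m ≤ n := by
    rw [secatB, hm] at h
    exact_mod_cast h
  -- The infimum is attained by a cover with `m + 1 ≤ n + 1` members; repeating `U 0` pads it to `n
  -- + 1`.
  refine ⟨fun i => if h : (i : ℕ) < m + 1 then U ⟨i, h⟩ else U 0, fun i => ?_,
    eq_univ_of_forall fun x => ?_⟩
  · dsimp only
    split_ifs
    exacts [hU _, hU _]
  · obtain ⟨i, hi⟩ := mem_iUnion.1 (hcov.ge (mem_univ x))
    refine mem_iUnion.2 ⟨⟨i, by omega⟩, ?_⟩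
    simpa [Nat.lt_succ_iff.1 i.2] using hi

theorem IsFibSectional.hasHLiftOn {U : Set X} (h : IsFibSectional f U) :
    HasHLiftOn f (FibMap.id X) U := by
  obtain ⟨s, hs⟩ := h.2
  exact ⟨s, hs.symm⟩

theorem HasHLiftOn.isFibSectional {U : Set X} (hU : IsOpen U)
    (h : HasHLiftOn f (FibMap.id X) U) : IsFibSectional f U := by
  obtain ⟨s, hs⟩ := h
  exact ⟨hU, s, hs.symm⟩

theorem exists_partition_of_secatB_le [NormalSpace X] {n : ℕ} (h : secatB f ≤ n) :
    ∃ ρ : Fin (n + 1) → C(X, ℝ), (∀ i x, 0 ≤ ρ i x) ∧ (∀ x, ∑ i, ρ i x = 1) ∧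
      ∀ i, HasHLiftOn f (FibMap.id X) {x | 0 < ρ i x} := by
  obtain ⟨U, hU, hcov⟩ := secatB_le_iff.1 h
  -- Normality of `X` enters here; local finiteness is automatic for a finite cover.
  obtain ⟨ρ, hρ⟩ := PartitionOfUnity.exists_isSubordinate_of_locallyFinite isClosed_univ U
    (fun i => (hU i).1) (locallyFinite_of_finite U) hcov.ge
  refine ⟨fun i => ρ i, fun i x => ρ.nonneg i x, fun x => ?_, fun i => ?_⟩
  · rw [← finsum_eq_sum_of_fintype]
    exact ρ.sum_eq_one (mem_univ x)
  · exact (hU i).hasHLiftOn.comp (X.incl _)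
      fun x => hρ i (subset_tsupport _ (ne_of_gt x.2 : ρ i x.1 ≠ 0))

end Covers

end

theorem theorem2p7 {B : Type u} [TopologicalSpace B] {E X : FibSpace B} (f : FibMap E X)
    (hf : (NormalSpace E ∧ NormalSpace X) ∨ (IsClosedFibCofibration f ∧ NormalSpace X)) (n : ℕ) :
    List.TFAE
      [secatB f ≤ (n : ℕ∞),
       ∃ φ : FibMap X (fatWedge f n), FibHomotopic (X.diag n) ((fatWedgeMap f n).comp φ),
       HasFibHomotopySection (ganeaMap f n)] := by
  have : NormalSpace X := hf.elim And.right And.right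
  tfae_have 1 → 2 := fun h => by
    obtain ⟨ρ, h0, h1, hρ⟩ := exists_partition_of_secatB_le h
    obtain ⟨φ, hφ⟩ := hasHLift_fatWedgeMap_of_partition f n (g := X.diag n) ρ h0 h1 fun i => by
      rw [X.coord_comp_diag]
      exact hρ i
    exact ⟨φ, hφ.symm⟩
  tfae_have 2 → 1 := fun ⟨φ, hφ⟩ => by
    obtain ⟨U, hU, hcov⟩ := exists_cover_of_hasHLift_fatWedgeMap f n ⟨φ, hφ.symm⟩
    refine secatB_le_iff.2 ⟨U, fun i => ?_, hcov⟩
    have := (hU i).2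
    rw [X.coord_comp_diag] at this
    exact this.isFibSectional (hU i).1
  tfae_have 1 → 3 := fun h => by
    obtain ⟨ρ, h0, h1, hρ⟩ := exists_partition_of_secatB_le h
    exact hasHLift_ganeaMap_of_partition f n ρ h0 h1 hρ
  tfae_have 3 → 1 := fun h => by
    obtain ⟨U, hU, hcov⟩ := exists_cover_of_hasHLift_ganeaMap f n h
    exact secatB_le_iff.2 ⟨U, fun i => (hU i).2.isFibSectional (hU i).1, hcov⟩
  tfae_finish
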